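/- Let $0<\alpha<H<1$ and $\sigma\in\mathbb R\setminus\{0\}$, and let $B=(B_t)_{t\ge 0}$ be a fractional Brownian motion of Hurst parameter $H$ (a centered Gaussian process with covariance $\mathbb E[B_sB_t]=\tfrac12\left(s^{2H}+t^{2H}-|t-s|^{2H}\right)$) on a probability space, whose paths are almost surely $\alpha$-Hölder continuous on every $[0,T]$. Let $b:(0,\infty)\to\mathbb R$ satisfy: 1. $b$ is $\lfloor 1/\alpha\rfloor+1$ times continuously differentiable, and its derivatives of orders $1,\dots,\lfloor 1/\alpha\rfloor+1$ are bounded on $[\varepsilon,\infty)$ for every $\varepsilon>0$; 2. there is $K>0$ such that $b'(x)<-K$ for all $x>0$; 3. there is $R>0$ such that $b(x)>-Rx$ for all $x>0$; 4. for every $C>0$, either $\int_0^T b(Ct^\alpha)\,dt=\infty$ for all $T>0$, or $\lim_{T\to 0^+}T^{-\alpha}\int_0^T b(Ct^\alpha)\,dt=\infty$. For $x_0>0$ let $X(x_0)$ be the (pathwise unique) continuous $(0,\infty)$-valued solution on $[0,\infty)$ of $$X_t=x_0+\int_0^t b(X_s)\,ds+\sigma B_t,\qquad t\ge 0,$$ and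 let $X_t(0):=\lim_{y\to 0^+}X_t(y)$ for $t\ge 0$. Then the equation $b(x)=0$ has a unique solution $x_b>0$ and, for every $x_0\ge 0$ and every $t_*\ge 0$, almost surely $$\tau_{t_*}(x_b):=\inf\{t>t_*: X_t(x_0)=x_b\}<\infty\qquad(\inf\emptyset=\infty).$$ -/

import Mathlib

open MeasureTheory ProbabilityTheory Filter Topology
open scoped NNReal ENNReal

/-- `w : ℝ₊ → ℝ` is locally `α`-Hölder continuous: `α`-Hölder on every `[0, T]`. -/
def LocallyHolder (α : ℝ) (w : ℝ≥0 → ℝ) : Prop :=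
  ∀ T : ℝ≥0, ∃ C : ℝ, ∀ s t : ℝ≥0, s ≤ T → t ≤ T →
    |w t - w s| ≤ C * |(t : ℝ) - (s : ℝ)| ^ α

/-- `B = (B_t)_{t ≥ 0}` is a fractional Brownian motion of Hurst parameter `H`: a centered
Gaussian process with covariance `(s ^ (2H) + t ^ (2H) - |t - s| ^ (2H)) / 2`. -/
structure IsFractionalBrownianMotion {Ω : Type*} [MeasurableSpace Ω]
    (H : ℝ) (B : ℝ≥0 → Ω → ℝ) (P : Measure Ω) : Prop where
  gaussian : IsGaussianProcess B P
  centered : ∀ t, ∫ ω, B t ω ∂P = 0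
  covariance_eq : ∀ s t : ℝ≥0, cov[B s, B t; P] =
    ((s : ℝ) ^ (2 * H) + (t : ℝ) ^ (2 * H) - |(t : ℝ) - (s : ℝ)| ^ (2 * H)) / 2

/-- The assumptions on the drift `b : (0, ∞) → ℝ` (a function on `ℝ` of which only the values
at positive reals matter). -/
structure DriftAssumption (α : ℝ) (b : ℝ → ℝ) : Prop where
  /-- `b` is `⌊1/α⌋ + 1` times continuously differentiable on `(0, ∞)`. -/
  contDiffOn : ContDiffOn ℝ ((⌊1 / α⌋₊ + 1 : ℕ) : WithTop ℕ∞) b (Set.Ioi 0)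
  /-- The derivatives of `b` of orders `1, …, ⌊1/α⌋ + 1` are bounded on every `[ε, ∞)`. -/
  bounded_derivatives : ∀ ε : ℝ, 0 < ε → ∀ k : ℕ, 1 ≤ k → k ≤ ⌊1 / α⌋₊ + 1 →
    ∃ M : ℝ, ∀ x : ℝ, ε ≤ x → |iteratedDeriv k b x| ≤ M
  deriv_lt : ∃ K : ℝ, 0 < K ∧ ∀ x : ℝ, 0 < x → deriv b x < -K
  gt_linear : ∃ R : ℝ, 0 < R ∧ ∀ x : ℝ, 0 < x → -R * x < b x
  /-- For every `C > 0`, either `∫₀ᵀ b(C t^α) dt = ∞` for every `T > 0`, or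
  `T^(-α) ∫₀ᵀ b(C t^α) dt → ∞` as `T → 0+`. By `gt_linear` the negative part of the integrand
  is bounded on `(0, T]`, so the integral is infinite exactly when that of the positive part
  is. In the second alternative the integrals are finite. -/
  singular : ∀ C : ℝ, 0 < C →
    (∀ T : ℝ, 0 < T → ∫⁻ t in Set.Ioc 0 T, ENNReal.ofReal (b (C * t ^ α)) = ∞) ∨
    ((∀ T : ℝ, 0 < T → IntervalIntegrable (fun t => b (C * t ^ α)) volume 0 T) ∧
      Tendsto (fun T : ℝ => 1 / T ^ α * ∫ t in (0 : ℝ)..T, b (C * t ^ α)) (𝓝[>] 0) atTop)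

/-- `x : ℝ₊ → ℝ` is a continuous, `(0, ∞)`-valued solution on `ℝ₊` of
`x_t = x₀ + ∫₀ᵗ b(x_s) ds + σ w_t`. -/
structure IsPositiveSolution (b : ℝ → ℝ) (σ : ℝ) (w : ℝ≥0 → ℝ) (x₀ : ℝ)
    (x : ℝ≥0 → ℝ) : Prop where
  continuous : Continuous x
  pos : ∀ t, 0 < x t
  integral_eq : ∀ t : ℝ≥0, x t = x₀ + (∫ s in (0 : ℝ)..t, b (x s.toNNReal)) + σ * w t

open Classical in
/-- The unique positive solution started at `x₀ > 0` and driven by the path `w`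
(the zero path if there is no solution, or more than one). -/
noncomputable def positiveSolution (b : ℝ → ℝ) (σ : ℝ) (w : ℝ≥0 → ℝ) (x₀ : ℝ) : ℝ≥0 → ℝ :=
  if h : ∃! x : ℝ≥0 → ℝ, IsPositiveSolution b σ w x₀ x then h.choose else 0

open Classical in
/-- The solution map `x_t(x₀, w)` for `x₀ ≥ 0`: the unique positive solution if `x₀ > 0`, and the
limit of `x_t(y, w)` as `y → 0+` if `x₀ = 0`. -/
noncomputable def itoMap (b : ℝ → ℝ) (σ : ℝ) (w : ℝ≥0 → ℝ) (x₀ t : ℝ≥0) : ℝ :=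
  if 0 < x₀ then positiveSolution b σ w x₀ t
  else limUnder (𝓝[>] (0 : ℝ)) (fun y : ℝ => positiveSolution b σ w y t)

/-- `τ_s(z) = inf {t > s : x_t = z}`, with `inf ∅ = ∞`. -/
noncomputable def hitAfter (x : ℝ≥0 → ℝ) (s : ℝ≥0) (z : ℝ) : ℝ≥0∞ :=
  ⨅ (t : ℝ≥0) (_ : s < t ∧ x t = z), (t : ℝ≥0∞)

/-! The drift `b` is strictly decreasing, takes a positive value because of its singularity at zero,
and becomes negative because its slope stays below `-K`; so it has exactly one root `z`. While a
solution lies above `z` its drift is nonpositive and its increments are at most those of `σ B`;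
while it lies below, they are at least those of `σ B`. A path avoiding `z` after some time would
stay on one side forever, and `σ B` would then be bounded on that side. But almost every path of `B`
is unbounded in both directions (`ae_unbounded_above`, applied to `B` and `-B`). The pathwise
conclusion is `exists_itoMap_eq_root`; for `x₀ = 0` the same inequalities pass to the limit `y →
0+`.

As `itoMap` has a default value, well-posedness must be proved too
(`existsUnique_isPositiveSolution`). Uniqueness holds because a decreasing drift contracts
distances. For existence the drift is truncated near zero, and `exists_shift` shows that the
truncation is never felt.

Unboundedness of `B` comes from sampling at times `q, q², …, qⁿ` with `q` large: the normalised
values are almost uncorrelated standard Gaussians, which are unlikely to be all nearly nonpositive.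
-/

/-! ### Consequences of the drift assumptions. -/

namespace DriftAssumption

variable {α : ℝ} {b : ℝ → ℝ}

lemma differentiableOn (hb : DriftAssumption α b) : DifferentiableOn ℝ b (Set.Ioi 0) :=
  hb.contDiffOn.differentiableOn (by simp)

lemma continuousOn (hb : DriftAssumption α b) : ContinuousOn b (Set.Ioi 0) :=
  hb.differentiableOn.continuousOn

lemma strictAntiOn (hb : DriftAssumption α b) : StrictAntiOn b (Set.Ioi 0) := by
  obtain ⟨K, hK, hd⟩ := hb.deriv_lt
  refine strictAntiOn_of_deriv_neg (convex_Ioi 0) hb.continuousOn fun x hx => ?_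
  rw [interior_Ioi] at hx
  linarith [hd x hx]

lemma le_of_le (hb : DriftAssumption α b) {x y : ℝ} (hx : 0 < x) (hxy : x ≤ y) : b y ≤ b x :=
  hb.strictAntiOn.antitoneOn hx (hx.trans_le hxy) hxy

/-- A nonpositive drift would contradict both alternatives of `singular`, already for `C = 1`. -/
lemma exists_pos_value (hb : DriftAssumption α b) : ∃ x, 0 < x ∧ 0 < b x := by
  by_contra! h
  rcases hb.singular 1 one_pos with h1 | ⟨-, h2⟩
  · have h0 : ∫⁻ t in Set.Ioc 0 1, ENNReal.ofReal (b (1 * t ^ α)) = 0 := by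
      rw [setLIntegral_congr_fun (g := fun _ => 0) measurableSet_Ioc]
      · simp
      · intro t ht
        exact ENNReal.ofReal_of_nonpos (h _ (by have := Real.rpow_pos_of_pos ht.1 α; linarith))
    exact absurd ((h1 1 one_pos).symm.trans h0) (by simp)
  · obtain ⟨T, hT, hT0⟩ := ((h2.eventually_gt_atTop 0).and self_mem_nhdsWithin).exists
    have hT0 : 0 < T := hT0
    have hi : ∫ t in (0 : ℝ)..T, b (1 * t ^ α) ≤ 0 := by
      rw [intervalIntegral.integral_of_le hT0.le]
      refine setIntegral_nonpos measurableSet_Ioc fun t ht => h _ ?_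
      have := Real.rpow_pos_of_pos ht.1 α
      linarith
    have := mul_nonpos_of_nonneg_of_nonpos (one_div_nonneg.2 (Real.rpow_pos_of_pos hT0 α).le) hi
    linarith

lemma exists_neg_value (hb : DriftAssumption α b) : ∃ x, 0 < x ∧ b x < 0 := by
  obtain ⟨K, hK, hd⟩ := hb.deriv_lt
  have key : ∀ y, 1 ≤ y → b y - b 1 ≤ -K * (y - 1) := fun y hy =>
    (convex_Ioi (0 : ℝ)).image_sub_le_mul_sub_of_deriv_le hb.continuousOn
      (by rw [interior_Ioi]; exact hb.differentiableOn)
      (fun x hx => by rw [interior_Ioi] at hx; exact (hd x hx).le) 1 (Set.mem_Ioi.2 one_pos) y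
      (Set.mem_Ioi.2 (by linarith)) hy
  -- Descending at rate `K` from `b 1`, the drift is at most `-1` here.
  refine ⟨1 + (|b 1| + 1) / K, by positivity, ?_⟩
  have h := key (1 + (|b 1| + 1) / K) (by have : 0 ≤ (|b 1| + 1) / K := by positivity
                                          linarith)
  have : -K * (1 + (|b 1| + 1) / K - 1) = -(|b 1| + 1) := by field_simp; ring
  linarith [le_abs_self (b 1)]

lemma exists_root (hb : DriftAssumption α b) :
    ∃ z, 0 < z ∧ b z = 0 ∧ ∀ y, 0 < y → b y = 0 → y = z := by
  obtain ⟨x, hx, hbx⟩ := hb.exists_pos_value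
  obtain ⟨y, hy, hby⟩ := hb.exists_neg_value
  have hxy : x ≤ y := by
    by_contra! h
    linarith [hb.le_of_le hy h.le]
  obtain ⟨z, hz, hz0⟩ := intermediate_value_Icc' hxy
    (hb.continuousOn.mono fun u hu => hx.trans_le hu.1) ⟨hby.le, hbx.le⟩
  have hz' : 0 < z := hx.trans_le hz.1
  exact ⟨z, hz', hz0, fun u hu hu0 => hb.strictAntiOn.injOn hu hz' (hu0.trans hz0.symm)⟩

/-- Away from zero this makes a truncated drift globally Lipschitz. -/
lemma exists_lipschitzOnWith (hb : DriftAssumption α b) {ε : ℝ} (hε : 0 < ε) :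
    ∃ K : ℝ≥0, LipschitzOnWith K b (Set.Ici ε) := by
  obtain ⟨M, hM⟩ := hb.bounded_derivatives ε hε 1 le_rfl (by simp)
  refine ⟨M.toNNReal, (convex_Ici ε).lipschitzOnWith_of_nnnorm_deriv_le (fun x hx => ?_)
    fun x hx => ?_⟩
  · exact hb.differentiableOn.differentiableAt (Ioi_mem_nhds (hε.trans_le hx))
  · have h := hM x hx
    rw [iteratedDeriv_one] at h
    rw [← NNReal.coe_le_coe, coe_nnnorm, Real.norm_eq_abs]
    exact h.trans (Real.le_coe_toNNReal M)

/-- The singularity of the drift at zero is strong enough to beat an `α`-Hölder perturbation,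
already for the shifted drift `x ↦ b (ε + x)` with small `ε`. -/
lemma exists_shift (hb : DriftAssumption α b) (hα : 0 < α) {C δ : ℝ} (hC : 0 < C) (hδ : 0 < δ)
    (hpos : ∀ x, 0 < x → x ≤ δ → 0 ≤ b x) :
    ∃ h ε : ℝ, 0 < h ∧ 0 < ε ∧ ε ≤ δ / 2 ∧ C * h ^ α < δ / 2 ∧
      C * h ^ α < ∫ u in (0 : ℝ)..h, b (ε + C * u ^ α) := by
  -- Below `h₀` the argument `ε + C * u ^ α` stays at most `δ` when `ε ≤ δ / 2`, so `b` is
  -- nonnegative there and Lebesgue integrals of `ENNReal.ofReal` lose nothing.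
  obtain ⟨h₀, hh₀, hCh₀⟩ : ∃ h₀ : ℝ, 0 < h₀ ∧ C * h₀ ^ α < δ / 2 := by
    refine ⟨(δ / (4 * C)) ^ α⁻¹, by positivity, ?_⟩
    rw [Real.rpow_inv_rpow (by positivity) hα.ne']
    field_simp
    norm_num
  have hsmall : ∀ u, 0 < u → u ≤ h₀ → 0 < C * u ^ α ∧ C * u ^ α < δ / 2 := fun u hu hu' =>
    ⟨by positivity, lt_of_le_of_lt (by gcongr) hCh₀⟩
  -- Stated with `∫⁻`, this covers the infinite and the finite alternative at once.
  obtain ⟨h, hh, hh', hlt⟩ : ∃ h, 0 < h ∧ h ≤ h₀ ∧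
      ENNReal.ofReal (C * h ^ α) < ∫⁻ u in Set.Ioc 0 h, ENNReal.ofReal (b (C * u ^ α)) := by
    rcases hb.singular C hC with h1 | ⟨hint, h2⟩
    · exact ⟨h₀, hh₀, le_rfl, by rw [h1 h₀ hh₀]; exact ENNReal.ofReal_lt_top⟩
    · obtain ⟨T, hT, hT1, hT2⟩ := ((h2.eventually_gt_atTop C).and
        (Ioc_mem_nhdsGT hh₀)).exists
      refine ⟨T, hT1, hT2, ?_⟩
      have hTα := Real.rpow_pos_of_pos hT1 α
      have hlt : C * T ^ α < ∫ t in (0 : ℝ)..T, b (C * t ^ α) := by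
        rw [one_div, inv_mul_eq_div, lt_div_iff₀ hTα] at hT
        exact hT
      rw [intervalIntegral.integral_of_le hT1.le] at hlt
      rw [← ofReal_integral_eq_lintegral_ofReal]
      · exact (ENNReal.ofReal_lt_ofReal_iff_of_nonneg (by positivity)).2 hlt
      · exact (intervalIntegrable_iff_integrableOn_Ioc_of_le hT1.le).1 (hint T hT1)
      · filter_upwards [ae_restrict_mem measurableSet_Ioc] with u hu
        obtain ⟨h3, h4⟩ := hsmall u hu.1 (hu.2.trans hT2)
        exact hpos _ h3 (by linarith)
  have hcont : ∀ ε, 0 ≤ ε → ContinuousOn (fun u => b (ε + C * u ^ α)) (Set.Ioc 0 h) := by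
    intro ε hε
    refine hb.continuousOn.comp (t := Set.Ioi 0) ?_ fun u hu => ?_
    · exact (continuous_const.add (continuous_const.mul
        (Real.continuous_rpow_const hα.le))).continuousOn
    · have := (hsmall u hu.1 (hu.2.trans hh')).1
      exact Set.mem_Ioi.2 (by linarith)
  let e : ℕ → ℝ := fun n => δ / 2 * (1 / ((n : ℝ) + 1))
  have he0 : ∀ n, 0 < e n := fun n => by positivity
  have he1 : ∀ n, e n ≤ δ / 2 := fun n => by
    refine mul_le_of_le_one_right (by positivity) ?_
    rw [div_le_one (by positivity)]
    linarith [n.cast_nonneg (α := ℝ)]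
  have he2 : Antitone e := fun n m hnm =>
    mul_le_mul_of_nonneg_left (one_div_le_one_div_of_le (by positivity) (by gcongr)) (by positivity)
  have he3 : Tendsto e atTop (𝓝 0) := by
    have := (tendsto_one_div_add_atTop_nhds_zero_nat (𝕜 := ℝ)).const_mul (δ / 2)
    rwa [mul_zero] at this
  -- Monotone convergence: `b` is antitone, so the integrands increase as `e n` decreases to zero.
  have hlim : Tendsto (fun n => ∫⁻ u in Set.Ioc 0 h, ENNReal.ofReal (b (e n + C * u ^ α))) atTop
      (𝓝 (∫⁻ u in Set.Ioc 0 h, ENNReal.ofReal (b (C * u ^ α)))) := by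
    refine lintegral_tendsto_of_tendsto_of_monotone (fun n => ?_) ?_ ?_
    · exact ((hcont _ (he0 n).le).aemeasurable measurableSet_Ioc).ennreal_ofReal
    · filter_upwards [ae_restrict_mem measurableSet_Ioc] with u hu n m hnm
      have h3 := (hsmall u hu.1 (hu.2.trans hh')).1
      exact ENNReal.ofReal_le_ofReal (hb.le_of_le (by linarith [he0 m]) (by linarith [he2 hnm]))
    · filter_upwards [ae_restrict_mem measurableSet_Ioc] with u hu
      have h3 := (hsmall u hu.1 (hu.2.trans hh')).1
      refine (ENNReal.continuous_ofReal.tendsto _).comp ?_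
      refine (hb.continuousOn.continuousAt (Ioi_mem_nhds h3)).tendsto.comp ?_
      simpa using he3.add_const (C * u ^ α)
  obtain ⟨n, hn⟩ := (hlim.eventually_const_lt hlt).exists
  refine ⟨h, e n, hh, he0 n, he1 n, (hsmall h hh hh').2, ?_⟩
  rw [intervalIntegral.integral_of_le hh.le]
  have hcl : ContinuousOn (fun u => b (e n + C * u ^ α)) (Set.Icc 0 h) := by
    refine hb.continuousOn.comp (t := Set.Ioi 0) ?_ fun u hu => ?_
    · exact (continuous_const.add (continuous_const.mul
        (Real.continuous_rpow_const hα.le))).continuousOn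
    · have : 0 ≤ u ^ α := Real.rpow_nonneg hu.1 α
      exact Set.mem_Ioi.2 (by have := he0 n; positivity)
  rw [← ofReal_integral_eq_lintegral_ofReal (hcl.integrableOn_Icc.mono_set Set.Ioc_subset_Icc_self)]
    at hn
  · exact (ENNReal.ofReal_lt_ofReal_iff_of_nonneg (by positivity)).1 hn
  · filter_upwards [ae_restrict_mem measurableSet_Ioc] with u hu
    obtain ⟨h3, h4⟩ := hsmall u hu.1 (hu.2.trans hh')
    exact hpos _ (by linarith [he0 n]) (by linarith [he1 n])

end DriftAssumption

/-! ### Contraction, uniqueness and comparison on a finite interval. -/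

/-- `x` is continuous, positive, and solves `x_t = x₀ + ∫₀ᵗ b(x_s) ds + σ w_t` for `t ∈ [0, T]`. -/
structure SolvesOn (b : ℝ → ℝ) (σ : ℝ) (w : ℝ → ℝ) (x₀ T : ℝ) (x : ℝ → ℝ) : Prop where
  continuous : Continuous x
  pos : ∀ t, 0 < x t
  integral_eq : ∀ t, 0 ≤ t → t ≤ T → x t = x₀ + (∫ s in (0 : ℝ)..t, b (x s)) + σ * w t

namespace SolvesOn

variable {α σ x₀ y₀ T : ℝ} {b w x y : ℝ → ℝ}

lemma mono (hx : SolvesOn b σ w x₀ T x) {T' : ℝ} (h : T' ≤ T) : SolvesOn b σ w x₀ T' x :=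
  ⟨hx.continuous, hx.pos, fun t h0 h1 => hx.integral_eq t h0 (h1.trans h)⟩

lemma continuous_drift (hb : DriftAssumption α b) (hx : SolvesOn b σ w x₀ T x) :
    Continuous fun t => b (x t) :=
  hb.continuousOn.comp_continuous hx.continuous hx.pos

lemma sub_eq (hb : DriftAssumption α b) (hx : SolvesOn b σ w x₀ T x) {s t : ℝ} (hs : 0 ≤ s)
    (hst : s ≤ t) (ht : t ≤ T) :
    x t - x s = (∫ u in s..t, b (x u)) + σ * (w t - w s) := by
  have hc := continuous_drift hb hx
  rw [hx.integral_eq t (hs.trans hst) ht, hx.integral_eq s hs (hst.trans ht),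
    ← intervalIntegral.integral_add_adjacent_intervals (hc.intervalIntegrable 0 s)
      (hc.intervalIntegrable s t)]
  ring

/-- The distance between two solutions driven by the same path is nonincreasing. -/
lemma abs_sub_le (hb : DriftAssumption α b) (hx : SolvesOn b σ w x₀ T x)
    (hy : SolvesOn b σ w y₀ T y) {s t : ℝ} (hs : 0 ≤ s) (hst : s ≤ t) (ht : t ≤ T) :
    |x t - y t| ≤ |x s - y s| := by
  have hxc := continuous_drift hb hx
  have hyc := continuous_drift hb hy
  -- The noise cancels in `x - y`, so the difference is differentiable although neither path need
  -- be.
  have hd : ∀ u ∈ Set.Ioo 0 T, HasDerivAt (fun u => (x u - y u) ^ 2)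
      (2 * (x u - y u) * (b (x u) - b (y u))) u := by
    intro u hu
    have h1 : HasDerivAt (fun u => (x₀ - y₀) + ((∫ s in (0 : ℝ)..u, b (x s)) -
        ∫ s in (0 : ℝ)..u, b (y s))) (b (x u) - b (y u)) u :=
      ((hxc.integral_hasStrictDerivAt 0 u).hasDerivAt.sub
        (hyc.integral_hasStrictDerivAt 0 u).hasDerivAt).const_add _
    have h2 : HasDerivAt (fun u => x u - y u) (b (x u) - b (y u)) u := by
      refine h1.congr_of_eventuallyEq ?_
      filter_upwards [Ioo_mem_nhds hu.1 hu.2] with v hv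
      rw [hx.integral_eq v hv.1.le hv.2.le, hy.integral_eq v hv.1.le hv.2.le]
      ring
    exact (h2.fun_pow 2).congr_deriv (by norm_num)
  have hanti : AntitoneOn (fun u => (x u - y u) ^ 2) (Set.Icc 0 T) := by
    refine antitoneOn_of_deriv_nonpos (convex_Icc 0 T)
      ((hx.continuous.sub hy.continuous).pow 2).continuousOn ?_ ?_
    · rw [interior_Icc]
      exact fun u hu => (hd u hu).differentiableAt.differentiableWithinAt
    · rw [interior_Icc]
      intro u hu
      rw [(hd u hu).deriv]
      rcases le_total (x u) (y u) with h | h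
      · have := hb.le_of_le (hx.pos u) h
        nlinarith
      · have := hb.le_of_le (hy.pos u) h
        nlinarith
  exact sq_le_sq.1 (hanti ⟨hs, hst.trans ht⟩ ⟨hs.trans hst, ht⟩ hst)

lemma initial (hx : SolvesOn b σ w x₀ T x) (hT : 0 ≤ T) (hw : w 0 = 0) : x 0 = x₀ := by
  simpa [hw] using hx.integral_eq 0 le_rfl hT

lemma eq_of_initial_eq (hb : DriftAssumption α b) (hx : SolvesOn b σ w x₀ T x)
    (hy : SolvesOn b σ w x₀ T y) {t : ℝ} (ht0 : 0 ≤ t) (ht : t ≤ T) : x t = y t := by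
  have h := abs_sub_le hb hx hy le_rfl ht0 ht
  have h0 : x 0 = y 0 := by
    have hT := ht0.trans ht
    rw [hx.integral_eq 0 le_rfl hT, hy.integral_eq 0 le_rfl hT]
    simp
  rw [h0, sub_self, abs_zero] at h
  exact sub_eq_zero.1 (abs_nonpos_iff.1 h)

/-- Comparison of solutions driven by the same path. -/
lemma le_of_initial_le (hb : DriftAssumption α b) (hx : SolvesOn b σ w x₀ T x)
    (hy : SolvesOn b σ w y₀ T y) (h : x₀ ≤ y₀) {t : ℝ} (ht0 : 0 ≤ t) (ht : t ≤ T) :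
    x t ≤ y t := by
  by_contra! hlt
  have h0 : x 0 ≤ y 0 := by
    have hT := ht0.trans ht
    rw [hx.integral_eq 0 le_rfl hT, hy.integral_eq 0 le_rfl hT]
    simpa using h
  -- If `x` overtook `y`, the two would meet at some `s`, and the contraction would keep them
  -- together from then on.
  obtain ⟨s, hs, hs0⟩ := intermediate_value_Icc ht0
    (hx.continuous.sub hy.continuous).continuousOn
    (show (0 : ℝ) ∈ Set.Icc (x 0 - y 0) (x t - y t) from ⟨by linarith, by linarith⟩)
  have hs0 : x s - y s = 0 := hs0
  have h1 := abs_sub_le hb hx hy hs.1 hs.2 ht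
  rw [hs0, abs_zero] at h1
  linarith [le_abs_self (x t - y t)]

end SolvesOn

/-! ### Existence of positive solutions. -/

/-- Global solvability of an integral equation with bounded Lipschitz drift and additive noise. -/
lemma exists_solution_of_bounded_lipschitz {g w : ℝ → ℝ} {K L : ℝ≥0} (hg : LipschitzWith K g)
    (hgL : ∀ x, |g x| ≤ L) (hw : Continuous w) (σ x₀ : ℝ) {T : ℝ} (hT : 0 ≤ T) :
    ∃ x : ℝ → ℝ, Continuous x ∧
      ∀ t, 0 ≤ t → t ≤ T → x t = x₀ + (∫ s in (0 : ℝ)..t, g (x s)) + σ * w t := by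
  -- Picard–Lindelöf is applied to `y = x - σ w`; as the field is bounded by `L`, a ball of radius
  -- `L * T` reaches all of `[0, T]`.
  have hPL : IsPicardLindelof (fun t y => g (y + σ * w t)) (tmin := 0) (tmax := T)
      ⟨0, le_rfl, hT⟩ x₀ (L * T.toNNReal) 0 L K := by
    refine ⟨fun t _ => LipschitzWith.lipschitzOnWith ?_, fun y _ => ?_, fun t _ y _ => hgL _, ?_⟩
    · refine LipschitzWith.of_dist_le_mul fun y z => ?_
      simpa using hg.dist_le_mul (y + σ * w t) (z + σ * w t)
    · exact (hg.continuous.comp (continuous_const.add (continuous_const.mul hw))).continuousOn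
    · simp [hT]
  obtain ⟨y, hy0, hy⟩ := hPL.exists_eq_forall_mem_Icc_hasDerivWithinAt₀
  have hyc : ContinuousOn y (Set.Icc 0 T) := fun t ht => (hy t ht).continuousWithinAt
  refine ⟨fun t => Set.IccExtend hT ((Set.Icc 0 T).domRestrict y) t + σ * w t,
    ((continuousOn_iff_continuous_domRestrict.1 hyc).Icc_extend').add (continuous_const.mul hw), ?_⟩
  intro t ht0 ht
  have hext : ∀ s ∈ Set.Icc 0 T, Set.IccExtend hT ((Set.Icc 0 T).domRestrict y) s = y s :=
    fun s hs => by rw [Set.IccExtend_of_mem hT _ hs]; rfl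
  have hsub : Set.Icc 0 t ⊆ Set.Icc 0 T := Set.Icc_subset_Icc_right ht
  have hint : ∫ s in (0 : ℝ)..t, g (Set.IccExtend hT ((Set.Icc 0 T).domRestrict y) s + σ * w s) =
      ∫ s in (0 : ℝ)..t, g (y s + σ * w s) := by
    refine intervalIntegral.integral_congr fun s hs => ?_
    rw [Set.uIcc_of_le ht0] at hs
    simp only [hext s (hsub hs)]
  have hc : ContinuousOn (fun s => g (y s + σ * w s)) (Set.uIcc 0 t) := by
    rw [Set.uIcc_of_le ht0]
    exact hg.continuous.comp_continuousOn
      ((hyc.mono hsub).add (continuous_const.mul hw).continuousOn)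
  have hFTC := intervalIntegral.integral_eq_sub_of_hasDerivAt_of_le ht0 (hyc.mono hsub)
    (fun s hs => (hy s (hsub (Set.Ioo_subset_Icc_self hs))).hasDerivAt
      (Icc_mem_nhds hs.1 (hs.2.trans_le ht))) hc.intervalIntegrable
  have hy0' : y 0 = x₀ := hy0
  simp only [hint, hext t ⟨ht0, ht⟩]
  rw [hFTC, hy0']
  ring

/-- Existence of positive solutions up to any finite time. -/
lemma exists_solvesOn {α σ x₀ T : ℝ} {b w : ℝ → ℝ} (hb : DriftAssumption α b) (hα : 0 < α)
    (hT : 0 ≤ T) (hw : Continuous w) (hw0 : w 0 = 0) {c : ℝ}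
    (hc : ∀ s t, 0 ≤ s → s ≤ t → t ≤ T → |w t - w s| ≤ c * (t - s) ^ α) (hx₀ : 0 < x₀) :
    ∃ x, SolvesOn b σ w x₀ T x := by
  obtain ⟨z, hz, hbz, -⟩ := hb.exists_root
  obtain ⟨δ, hδ, hδx, hδz⟩ : ∃ δ, 0 < δ ∧ δ ≤ x₀ ∧ δ ≤ z :=
    ⟨min x₀ z, lt_min hx₀ hz, min_le_left _ _, min_le_right _ _⟩
  have hbpos : ∀ x, 0 < x → x ≤ δ → 0 ≤ b x := fun x hx hxδ =>
    hbz ▸ hb.le_of_le hx (hxδ.trans hδz)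
  obtain ⟨C, hC, hCw⟩ : ∃ C, 0 < C ∧
      ∀ s t, 0 ≤ s → s ≤ t → t ≤ T → |σ * (w t - w s)| ≤ C * (t - s) ^ α := by
    refine ⟨|σ| * |c| + 1, by positivity, fun s t h0 hst ht => ?_⟩
    have h1 := hc s t h0 hst ht
    have h2 : 0 ≤ (t - s) ^ α := Real.rpow_nonneg (by linarith) α
    rw [abs_mul]
    calc |σ| * |w t - w s| ≤ |σ| * (|c| * (t - s) ^ α) := by
          gcongr
          exact h1.trans (by gcongr; exact le_abs_self c)
      _ ≤ (|σ| * |c| + 1) * (t - s) ^ α := by nlinarith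
  obtain ⟨h, ε, hh, hε, hεδ, hhδ, hlt⟩ := hb.exists_shift hα hC hδ hbpos
  have hTα : 0 ≤ T ^ α := Real.rpow_nonneg hT α
  -- The truncated drift is at most `b ε`, so `N` bounds its solution from above on `[0, T]`.
  let N : ℝ := x₀ + |b ε| * T + C * T ^ α
  have hεN : ε ≤ N := by
    have : 0 ≤ |b ε| * T + C * T ^ α := by positivity
    simp only [N]; linarith
  let p : ℝ → ℝ := fun y => max ε (min y N)
  have hpε : ∀ y, ε ≤ p y := fun y => le_max_left _ _
  have hp0 : ∀ y, 0 < p y := fun y => hε.trans_le (hpε y)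
  have hpN : ∀ y, p y ≤ N := fun y => max_le hεN (min_le_right _ _)
  have hp : LipschitzWith 1 p := (LipschitzWith.id.min_const N).const_max ε
  obtain ⟨K, hK⟩ := hb.exists_lipschitzOnWith hε
  have hg : LipschitzWith K fun y => b (p y) := by
    have h1 : LipschitzWith (K * 1) (b ∘ p) :=
      lipschitzOnWith_univ.1 (hK.comp hp.lipschitzOnWith fun y _ => hpε y)
    rwa [mul_one] at h1
  obtain ⟨L, hL⟩ : ∃ L : ℝ≥0, ∀ y, |b (p y)| ≤ L := by
    refine ⟨(|b ε| + |b N|).toNNReal, fun y => le_trans ?_ (Real.le_coe_toNNReal _)⟩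
    have h1 := hb.le_of_le hε (hpε y)
    have h2 := hb.le_of_le (hp0 y) (hpN y)
    rw [abs_le]
    constructor <;>
      linarith [neg_abs_le (b N), le_abs_self (b ε), abs_nonneg (b ε), abs_nonneg (b N)]
  obtain ⟨x, hxc, hx⟩ := exists_solution_of_bounded_lipschitz hg hL hw σ x₀ hT
  have hgc : Continuous fun s => b (p (x s)) := hg.continuous.comp hxc
  have hinc : ∀ s t, 0 ≤ s → s ≤ t → t ≤ T →
      x t - x s = (∫ u in s..t, b (p (x u))) + σ * (w t - w s) := by
    intro s t hs hst ht
    rw [hx t (hs.trans hst) ht, hx s hs (hst.trans ht),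
      ← intervalIntegral.integral_add_adjacent_intervals (hgc.intervalIntegrable 0 s)
        (hgc.intervalIntegrable s t)]
    ring
  have hx0 : x 0 = x₀ := by simpa [hw0] using hx 0 le_rfl hT
  have hxN : ∀ t, 0 ≤ t → t ≤ T → x t ≤ N := by
    intro t ht0 ht
    have h1 : ∫ u in (0 : ℝ)..t, b (p (x u)) ≤ ∫ u in (0 : ℝ)..t, |b ε| :=
      intervalIntegral.integral_mono_on ht0 (hgc.intervalIntegrable _ _)
        intervalIntegrable_const fun u _ => (hb.le_of_le hε (hpε _)).trans (le_abs_self _)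
    rw [intervalIntegral.integral_const, smul_eq_mul, sub_zero] at h1
    have h2 := hinc 0 t le_rfl ht0 ht
    have h3 := (le_abs_self _).trans (hCw 0 t le_rfl ht0 ht)
    have h4 : C * (t - 0) ^ α ≤ C * T ^ α := by rw [sub_zero]; gcongr
    have h5 : t * |b ε| ≤ |b ε| * T := by rw [mul_comm]; gcongr
    simp only [N]
    linarith
  -- Let `τ` be a minimum point with `x τ ≤ ε`, and `s` the last time before `τ` with `x s ≥ δ`.
  -- After `s` the drift is nonnegative, so `x` lies below `ε + C * (τ - u) ^ α`. By `exists_shift`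
  -- the drift collected on `[τ - h, τ]` then exceeds the noise, so `x (τ - h) < x τ`, against
  -- minimality.
  have hxε : ∀ t, 0 ≤ t → t ≤ T → ε < x t := by
    by_contra! hcon
    obtain ⟨t₁, ht₁0, ht₁, hxt₁⟩ := hcon
    obtain ⟨τ, ⟨hτ0, hτT⟩, hmin⟩ := isCompact_Icc.exists_isMinOn
      (Set.nonempty_Icc.2 hT) hxc.continuousOn (s := Set.Icc 0 T)
    have hmin : ∀ u, 0 ≤ u → u ≤ T → x τ ≤ x u := fun u h0 h1 => hmin ⟨h0, h1⟩
    have hxτ : x τ ≤ ε := (hmin t₁ ht₁0 ht₁).trans hxt₁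
    obtain ⟨s, ⟨⟨hs0, hsτ⟩, hxs⟩, hsmax⟩ :=
      (isCompact_Icc.inter_right (isClosed_le continuous_const hxc) :
        IsCompact (Set.Icc 0 τ ∩ {u | δ ≤ x u})).exists_isGreatest
        ⟨0, ⟨le_rfl, hτ0⟩, by rw [Set.mem_ofPred_eq, hx0]; exact hδx⟩
    have hxs : δ ≤ x s := hxs
    have hg0 : ∀ u ∈ Set.Ioc s τ, 0 ≤ b (p (x u)) := by
      intro u hu
      have hu1 : x u < δ := by
        by_contra! hcon
        exact absurd (hsmax ⟨⟨hs0.trans hu.1.le, hu.2⟩, hcon⟩) (not_le.2 hu.1)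
      exact hbpos _ (hp0 _) (max_le (by linarith) ((min_le_left _ _).trans hu1.le))
    have hup : ∀ u, s ≤ u → u ≤ τ → x u ≤ ε + C * (τ - u) ^ α := by
      intro u hsu huτ
      have h1 : 0 ≤ ∫ v in u..τ, b (p (x v)) := by
        rw [intervalIntegral.integral_of_le huτ]
        exact setIntegral_nonneg measurableSet_Ioc fun v hv => hg0 v ⟨hsu.trans_lt hv.1, hv.2⟩
      have h2 := hinc u τ (hs0.trans hsu) huτ hτT
      have h3 := (neg_le_abs _).trans (hCw u τ (hs0.trans hsu) huτ hτT)
      linarith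
    -- Climbing from at most `ε ≤ δ / 2` back to `δ` needs `C * (τ - s) ^ α ≥ δ / 2 > C * h ^ α`.
    have hhs : h < τ - s := by
      have h1 := hup s le_rfl hsτ
      have h2 : C * h ^ α < C * (τ - s) ^ α := by linarith
      exact (Real.rpow_lt_rpow_iff hh.le (by linarith) hα).1 (lt_of_mul_lt_mul_left h2 hC.le)
    have h1 : ∫ u in (τ - h)..τ, b (ε + C * (τ - u) ^ α) ≤ ∫ u in (τ - h)..τ, b (p (x u)) := by
      have hτh : τ - h ≤ τ := by linarith
      refine intervalIntegral.integral_mono_on hτh (ContinuousOn.intervalIntegrable ?_)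
        (hgc.intervalIntegrable _ _) fun u hu => hb.le_of_le (hp0 _) ?_
      · rw [Set.uIcc_of_le hτh]
        refine hb.continuousOn.comp (t := Set.Ioi 0) ?_ fun u hu => ?_
        · exact (continuous_const.add (continuous_const.mul ((Real.continuous_rpow_const
            hα.le).comp (continuous_const.sub continuous_id)))).continuousOn
        · have : 0 ≤ (τ - u) ^ α := Real.rpow_nonneg (by linarith [hu.2]) α
          exact Set.mem_Ioi.2 (by positivity)
      · have h2 : 0 ≤ (τ - u) ^ α := Real.rpow_nonneg (by linarith [hu.2]) α
        refine max_le (le_add_of_nonneg_right (by positivity))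
          ((min_le_left _ _).trans (hup u (by linarith [hu.1]) hu.2))
    rw [intervalIntegral.integral_comp_sub_left (fun v => b (ε + C * v ^ α)), sub_self,
      sub_sub_cancel] at h1
    have h2 := hinc (τ - h) τ (by linarith) (by linarith) hτT
    have h3 := (neg_le_abs _).trans (hCw (τ - h) τ (by linarith) (by linarith) hτT)
    rw [sub_sub_cancel] at h3
    have h4 := hmin (τ - h) (by linarith) (by linarith)
    linarith
  -- `SolvesOn` asks for positivity on all of `ℝ`, so the path is frozen outside `[0, T]`.
  have hproj : ∀ t, 0 ≤ max 0 (min t T) ∧ max 0 (min t T) ≤ T := fun t =>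
    ⟨le_max_left _ _, max_le hT (min_le_right _ _)⟩
  refine ⟨fun t => x (max 0 (min t T)),
    hxc.comp (continuous_const.max (continuous_id.min continuous_const)),
    fun t => hε.trans (hxε _ (hproj t).1 (hproj t).2), fun t ht0 ht => ?_⟩
  have hid : ∀ u, 0 ≤ u → u ≤ T → max 0 (min u T) = u := fun u h0 h1 => by
    rw [min_eq_left h1, max_eq_right h0]
  have hint : ∫ s in (0 : ℝ)..t, b (x (max 0 (min s T))) = ∫ s in (0 : ℝ)..t, b (p (x s)) := by
    refine intervalIntegral.integral_congr fun u hu => ?_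
    rw [Set.uIcc_of_le ht0] at hu
    have hu' := hu.2.trans ht
    simp only [hid u hu.1 hu', p]
    rw [min_eq_left (hxN u hu.1 hu'), max_eq_right (hxε u hu.1 hu').le]
  simp only [hint, hid t ht0 ht]
  exact hx t ht0 ht

lemma LocallyHolder.continuous {α : ℝ} (hα : 0 < α) {w : ℝ≥0 → ℝ} (hw : LocallyHolder α w) :
    Continuous w := by
  refine continuous_iff_continuousAt.2 fun t => ?_
  obtain ⟨C, hC⟩ := hw (t + 1)
  refine tendsto_iff_dist_tendsto_zero.2 ?_
  have hlim : Tendsto (fun s : ℝ≥0 => C * |(s : ℝ) - t| ^ α) (𝓝 t) (𝓝 0) := by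
    have : Continuous fun s : ℝ≥0 => C * |(s : ℝ) - t| ^ α :=
      continuous_const.mul ((Real.continuous_rpow_const hα.le).comp
        (NNReal.continuous_coe.sub continuous_const).abs)
    simpa [Real.zero_rpow hα.ne'] using this.tendsto t
  refine squeeze_zero' (Eventually.of_forall fun _ => dist_nonneg) ?_ hlim
  filter_upwards [eventually_le_nhds (show t < t + 1 by simp)] with s hs
  exact hC t s (by simp) hs

/-! ### Global well-posedness for Hölder paths. -/

section Global

variable {α σ x₀ : ℝ} {b : ℝ → ℝ} {w : ℝ≥0 → ℝ}

lemma IsPositiveSolution.solvesOn {x : ℝ≥0 → ℝ} (hx : IsPositiveSolution b σ w x₀ x) (T : ℝ) :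
    SolvesOn b σ (fun t => w t.toNNReal) x₀ T (fun t => x t.toNNReal) := by
  refine ⟨hx.continuous.comp continuous_real_toNNReal, fun t => hx.pos _, fun t ht _ => ?_⟩
  have h := hx.integral_eq t.toNNReal
  rwa [Real.coe_toNNReal t ht] at h

/-- Existence and uniqueness of the positive solution driven by a Hölder path. -/
theorem existsUnique_isPositiveSolution (hb : DriftAssumption α b) (hα : 0 < α)
    (hw : LocallyHolder α w) (hw0 : w 0 = 0) (hx₀ : 0 < x₀) :
    ∃! x : ℝ≥0 → ℝ, IsPositiveSolution b σ w x₀ x := by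
  have hex : ∀ n : ℕ, ∃ x, SolvesOn b σ (fun t => w t.toNNReal) x₀ n x := by
    intro n
    obtain ⟨c, hc⟩ := hw n
    refine exists_solvesOn hb hα n.cast_nonneg ((hw.continuous hα).comp continuous_real_toNNReal)
      (by simpa using hw0) (c := c) (fun s t hs hst ht => ?_) hx₀
    have h := hc s.toNNReal t.toNNReal
      (by rw [Real.toNNReal_le_iff_le_coe]; simpa using hst.trans ht)
      (by rw [Real.toNNReal_le_iff_le_coe]; simpa using ht)
    rwa [Real.coe_toNNReal s hs, Real.coe_toNNReal t (hs.trans hst),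
      abs_of_nonneg (sub_nonneg.2 hst)] at h
  choose z hz using hex
  -- By uniqueness the solutions on `[0, n]` are consistent and can be glued.
  have hzz : ∀ (t : ℝ≥0) (n : ℕ), (t : ℝ) ≤ n → z ⌈t⌉₊ t = z n t := by
    intro t n htn
    have hle : ⌈t⌉₊ ≤ n := Nat.ceil_le.2 (by exact_mod_cast htn)
    exact (hz _).eq_of_initial_eq hb ((hz n).mono (by exact_mod_cast hle)) t.2
      (by exact_mod_cast Nat.le_ceil t)
  refine ⟨fun t => z ⌈t⌉₊ t, ⟨?_, fun t => (hz _).pos _, fun t => ?_⟩, ?_⟩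
  · refine continuous_iff_continuousAt.2 fun t => ?_
    -- The `+ 1` makes one solution serve a whole neighbourhood of `t`, even where `⌈t⌉₊` jumps.
    have hc : ContinuousAt (fun s : ℝ≥0 => z (⌈t⌉₊ + 1) s) t :=
      ((hz _).continuous.comp NNReal.continuous_coe).continuousAt
    refine hc.congr ?_
    have hlt : t < ((⌈t⌉₊ + 1 : ℕ) : ℝ≥0) := by
      push_cast
      exact (Nat.le_ceil t).trans_lt (by simp)
    filter_upwards [eventually_le_nhds hlt] with s hs
    exact (hzz s _ (by exact_mod_cast hs)).symm
  · have ht : (t : ℝ) ≤ ⌈t⌉₊ := by exact_mod_cast Nat.le_ceil t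
    have h := (hz ⌈t⌉₊).integral_eq t t.2 ht
    rw [Real.toNNReal_coe] at h
    simp only [h]
    congr 2
    refine intervalIntegral.integral_congr fun s hs => ?_
    rw [Set.uIcc_of_le t.coe_nonneg] at hs
    have h1 := hzz s.toNNReal ⌈t⌉₊ (by rw [Real.coe_toNNReal s hs.1]; exact hs.2.trans ht)
    rw [Real.coe_toNNReal s hs.1] at h1
    simp only [Real.coe_toNNReal s hs.1, h1]
  · intro y hy
    funext t
    have h := (hy.solvesOn _).eq_of_initial_eq hb (hz ⌈t⌉₊) t.2 (by exact_mod_cast Nat.le_ceil t)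
    simpa using h

lemma isPositiveSolution_positiveSolution (hb : DriftAssumption α b) (hα : 0 < α)
    (hw : LocallyHolder α w) (hw0 : w 0 = 0) (hx₀ : 0 < x₀) :
    IsPositiveSolution b σ w x₀ (positiveSolution b σ w x₀) := by
  have h := existsUnique_isPositiveSolution (σ := σ) hb hα hw hw0 hx₀
  rw [positiveSolution, dif_pos h]
  exact h.choose_spec.1

end Global

/-! ### Almost uncorrelated Gaussian variables. -/

/-- The density is at most `1 / √(2π) ≤ 1 / 2`, and the interval has length `2δ`. -/
lemma gaussianReal_Icc_le (m : ℝ) {δ : ℝ} :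
    gaussianReal 0 1 (Set.Icc (m - δ) (m + δ)) ≤ ENNReal.ofReal δ := by
  have hpdf : ∀ x, gaussianPDF 0 1 x ≤ ENNReal.ofReal (1 / 2) := by
    intro x
    refine ENNReal.ofReal_le_ofReal ?_
    have h2 : (2 : ℝ) ≤ √(2 * Real.pi * (1 : ℝ≥0)) := by
      refine Real.le_sqrt_of_sq_le ?_
      simp only [NNReal.coe_one]
      linarith [Real.pi_gt_three]
    rw [gaussianPDFReal_def]
    calc (√(2 * Real.pi * (1 : ℝ≥0)))⁻¹ * Real.exp (-(x - 0) ^ 2 / (2 * (1 : ℝ≥0)))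
        ≤ 2⁻¹ * 1 := by
          gcongr
          refine Real.exp_le_one_iff.2 ?_
          exact div_nonpos_of_nonpos_of_nonneg (by nlinarith [sq_nonneg (x - 0)]) (by positivity)
      _ = 1 / 2 := by norm_num
  rw [gaussianReal_apply _ one_ne_zero]
  calc ∫⁻ x in Set.Icc (m - δ) (m + δ), gaussianPDF 0 1 x
      ≤ ∫⁻ _ in Set.Icc (m - δ) (m + δ), ENNReal.ofReal (1 / 2) := lintegral_mono hpdf
    _ = ENNReal.ofReal δ := by
      rw [setLIntegral_const, Real.volume_Icc, ← ENNReal.ofReal_mul (by norm_num)]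
      congr 1
      ring

section AlmostUncorrelated

variable {Ω : Type*} [MeasurableSpace Ω] {P : Measure Ω} [IsProbabilityMeasure P]

lemma integral_sq_sum_le {n : ℕ} {Z : Fin n → Ω → ℝ} (hL : ∀ k, MemLp (Z k) 2 P)
    (hmean : ∀ k, ∫ ω, Z k ω ∂P = 0) (hvar : ∀ k, Var[Z k; P] = 1) {η : ℝ} (hη : 0 ≤ η)
    (hcov : ∀ j k, j ≠ k → cov[Z j, Z k; P] ≤ η) :
    ∫ ω, (∑ k, Z k ω) ^ 2 ∂P ≤ n + n ^ 2 * η := by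
  have h0 : ∫ ω, ∑ k, Z k ω ∂P = 0 := by
    rw [integral_finsetSum _ fun k _ => (hL k).integrable (by norm_num)]
    simp [hmean]
  have hae : AEMeasurable (fun ω => ∑ k, Z k ω) P :=
    Finset.aemeasurable_fun_sum _ fun k _ => (hL k).aestronglyMeasurable.aemeasurable
  have h1 := variance_of_integral_eq_zero hae h0
  calc ∫ ω, (∑ k, Z k ω) ^ 2 ∂P = Var[fun ω => ∑ k, Z k ω; P] := h1.symm
    _ = ∑ j, ∑ k, cov[Z j, Z k; P] := variance_fun_sum hL
    _ ≤ ∑ j : Fin n, ∑ k : Fin n, ((if j = k then 1 else 0) + η) := by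
      refine Finset.sum_le_sum fun j _ => Finset.sum_le_sum fun k _ => ?_
      split_ifs with h
      · rw [← h, covariance_self (hL j).aestronglyMeasurable.aemeasurable, hvar]
        linarith
      · simpa using hcov j k h
    _ = n + n ^ 2 * η := by
      simp [Finset.sum_add_distrib]
      ring

/-- Quantitative form of the fact that many almost uncorrelated standard Gaussian variables are
rarely all bounded above by a small number. -/
lemma prob_forall_le_bound {n : ℕ} (hn : 0 < n) {Z : Fin n → Ω → ℝ}
    (hZ : ∀ k, HasGaussianLaw (Z k) P)
    (hmean : ∀ k, ∫ ω, Z k ω ∂P = 0) (hvar : ∀ k, Var[Z k; P] = 1) {η : ℝ} (hη : 0 ≤ η)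
    (hcov : ∀ j k, j ≠ k → cov[Z j, Z k; P] ≤ η) {m δ κ : ℝ} (hm : 0 ≤ m) (hδ : 0 < δ)
    (hκ : 0 < κ) :
    δ * (P.real {ω | ∀ k, Z k ω ≤ m} - δ) ≤ m + κ + (1 / n + η) / κ := by
  set A : Set Ω := {ω | ∀ k, Z k ω ≤ m} with hA
  have hAm : NullMeasurableSet A P := by
    have : A = ⋂ k, {ω | Z k ω ≤ m} := by ext; simp [hA]
    rw [this]
    exact NullMeasurableSet.iInter fun k =>
      nullMeasurableSet_le (hZ k).aemeasurable aemeasurable_const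
  have hL : ∀ k, MemLp (Z k) 2 P := fun k => (hZ k).memLp_two
  have hI : ∀ k, Integrable (Z k) P := fun k => (hZ k).integrable
  have hAe : ∀ᵐ ω ∂P.restrict A, ω ∈ A := ae_restrict_mem₀ hAm
  -- On `A` the variable `m - Z k` is nonnegative, and it is below `δ` only if `Z k` falls in an
  -- interval of Gaussian mass at most `δ`; Markov's inequality does the rest.
  have hk : ∀ k, δ * (P.real A - δ) ≤ ∫ ω in A, (m - Z k ω) ∂P := by
    intro k
    have hMarkov := mul_meas_ge_le_integral_of_nonneg (μ := P.restrict A)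
      (f := fun ω => m - Z k ω) (by filter_upwards [hAe] with ω hω using sub_nonneg.2 (hω k))
      ((integrable_const m).sub (hI k)).integrableOn δ
    refine le_trans (mul_le_mul_of_nonneg_left ?_ hδ.le) hMarkov
    have hD : P.real (Z k ⁻¹' Set.Icc (m - δ) (m + δ)) ≤ δ := by
      have hlaw := (hZ k).map_eq_gaussianReal
      rw [hmean k, hvar k, Real.toNNReal_one] at hlaw
      rw [Measure.real, ← Measure.map_apply_of_aemeasurable (hZ k).aemeasurable measurableSet_Icc,
        hlaw]
      exact ENNReal.toReal_le_of_le_ofReal hδ.le (gaussianReal_Icc_le m)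
    have hsub : A ⊆ ({ω | δ ≤ m - Z k ω} ∩ A) ∪ Z k ⁻¹' Set.Icc (m - δ) (m + δ) := by
      intro ω hω
      by_cases h : δ ≤ m - Z k ω
      · exact Or.inl ⟨h, hω⟩
      · exact Or.inr ⟨by linarith, by linarith [hω k]⟩
    have h1 := (measureReal_mono hsub (measure_ne_top P _)).trans (measureReal_union_le _ _)
    have h2 : P.real ({ω | δ ≤ m - Z k ω} ∩ A) ≤ (P.restrict A).real {ω | δ ≤ m - Z k ω} :=
      ENNReal.toReal_mono (measure_ne_top _ _) (Measure.le_restrict_apply _ _)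
    linarith
  have hn' : (0 : ℝ) < n := by exact_mod_cast hn
  have ha : 0 < n * κ := by positivity
  have hsq : Integrable (fun ω => (∑ k, Z k ω) ^ 2) P :=
    (memLp_finsetSum _ fun k _ => hL k).integrable_sq
  have hsum : (n : ℝ) * (δ * (P.real A - δ)) ≤ ∫ ω in A, (n * m - ∑ k, Z k ω) ∂P := by
    have h1 : ∀ ω, n * m - ∑ k, Z k ω = ∑ k : Fin n, (m - Z k ω) := fun ω => by simp
    simp only [h1]
    have hmZ : ∀ k, Integrable (fun ω => m - Z k ω) P := fun k => (integrable_const m).sub (hI k)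
    rw [integral_finsetSum _ fun k _ => (hmZ k).integrableOn]
    have h2 := Finset.sum_le_sum fun k (_ : k ∈ Finset.univ) => hk k
    simpa using h2
  have hup : ∫ ω in A, (n * m - ∑ k, Z k ω) ∂P ≤
      n * m + n * κ + (n + n ^ 2 * η) / (n * κ) := by
    have hI2 : Integrable (fun ω => n * m + n * κ + (∑ k, Z k ω) ^ 2 / (n * κ)) P :=
      (integrable_const _).add (hsq.div_const _)
    calc ∫ ω in A, (n * m - ∑ k, Z k ω) ∂P
        ≤ ∫ ω in A, (n * m + n * κ + (∑ k, Z k ω) ^ 2 / (n * κ)) ∂P := by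
          refine integral_mono ((integrable_const _).sub
            (integrable_finsetSum _ fun k _ => hI k)).integrableOn hI2.integrableOn fun ω => ?_
          set U := ∑ k, Z k ω
          -- This trades the linear term for a square, whose expectation the covariance bound
          -- controls; it amounts to `U² + aU + a² ≥ 0` with `a = n * κ`.
          have h3 : -U - n * κ ≤ U ^ 2 / (n * κ) := by
            rw [le_div_iff₀ ha]
            nlinarith [sq_nonneg (U + n * κ)]
          show n * m - U ≤ n * m + n * κ + U ^ 2 / (n * κ)
          linarith
      _ ≤ ∫ ω, (n * m + n * κ + (∑ k, Z k ω) ^ 2 / (n * κ)) ∂P :=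
          setIntegral_le_integral hI2 (Eventually.of_forall fun ω => by
            show 0 ≤ n * m + n * κ + (∑ k, Z k ω) ^ 2 / (n * κ)
            positivity)
      _ = n * m + n * κ + (∫ ω, (∑ k, Z k ω) ^ 2 ∂P) / (n * κ) := by
          rw [integral_add (integrable_const _) (hsq.div_const _), integral_div]
          simp
      _ ≤ _ := by
          gcongr
          exact integral_sq_sum_le hL hmean hvar hη hcov
  have hfin : n * m + n * κ + (n + n ^ 2 * η) / (n * κ) = n * (m + κ + (1 / n + η) / κ) := by
    field_simp
  exact le_of_mul_le_mul_left (hfin ▸ hsum.trans hup) hn'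

end AlmostUncorrelated

/-! ### Unboundedness of fractional Brownian motion. -/

/-- The correlation of fractional Brownian motion at times `s ≤ t` is small when `s / t` is. -/
lemma fbm_correlation_le {H s t : ℝ} (hH0 : 0 < H) (hH1 : H < 1) (hs : 0 < s) (hst : s ≤ t) :
    (s ^ (2 * H) + t ^ (2 * H) - |t - s| ^ (2 * H)) / 2 / (s ^ H * t ^ H) ≤
      (s / t) ^ H + (s / t) ^ (1 - H) := by
  have ht : 0 < t := hs.trans_le hst
  obtain ⟨r, hr0, hr1, rfl⟩ : ∃ r, 0 < r ∧ r ≤ 1 ∧ s = r * t :=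
    ⟨s / t, by positivity, (div_le_one ht).2 hst, by field_simp⟩
  have h1 : |t - r * t| = (1 - r) * t := by
    rw [show t - r * t = (1 - r) * t by ring, abs_of_nonneg]
    exact mul_nonneg (by linarith) ht.le
  -- Since `2H ≤ 2` and `0 ≤ 1 - r ≤ 1`, lowering the exponent from `2` raises the power; the
  -- correlation is then at most `r ^ H / 2 + r ^ (1 - H)`.
  have h2 : 1 - 2 * r ≤ (1 - r) ^ (2 * H) := by
    calc 1 - 2 * r ≤ (1 - r) ^ 2 := by nlinarith [sq_nonneg r]
      _ = (1 - r) ^ (2 : ℝ) := by norm_cast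
      _ ≤ (1 - r) ^ (2 * H) :=
        Real.rpow_le_rpow_of_exponent_ge_of_imp (by linarith) (by linarith) (by linarith)
          (fun _ h => by linarith)
  have h3 : r ^ (2 * H) = r ^ H * r ^ H := by rw [← Real.rpow_add hr0]; ring_nf
  have h4 : r = r ^ H * r ^ (1 - H) := by rw [← Real.rpow_add hr0]; simp
  have h5 : t ^ (2 * H) = t ^ H * t ^ H := by rw [← Real.rpow_add ht]; ring_nf
  have htH := Real.rpow_pos_of_pos ht H
  have hrH := Real.rpow_pos_of_pos hr0 H
  rw [h1, Real.mul_rpow hr0.le ht.le, Real.mul_rpow (by linarith) ht.le,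
    Real.mul_rpow hr0.le ht.le, mul_div_cancel_right₀ _ ht.ne', div_le_iff₀ (by positivity), h3, h5]
  have h6 : 0 ≤ ((1 - r) ^ (2 * H) - (1 - 2 * r)) * (t ^ H * t ^ H) :=
    mul_nonneg (by linarith) (by positivity)
  have h7 : 0 ≤ r ^ H * r ^ H * (t ^ H * t ^ H) := by positivity
  have h8 : r * (t ^ H * t ^ H) = r ^ H * r ^ (1 - H) * (t ^ H * t ^ H) := by rw [← h4]
  nlinarith

namespace IsFractionalBrownianMotion

variable {Ω : Type*} [MeasurableSpace Ω] {P : Measure Ω} {H : ℝ} {B : ℝ≥0 → Ω → ℝ}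

lemma neg (hB : IsFractionalBrownianMotion H B P) :
    IsFractionalBrownianMotion H (fun t ω => -B t ω) P where
  gaussian := by simpa using hB.gaussian.smul (fun _ => -1)
  centered t := by rw [integral_neg, hB.centered, neg_zero]
  covariance_eq s t := by
    rw [← hB.covariance_eq s t]
    simp

/-- The variance at time zero vanishes; `H = 0` is excluded because `0 ^ 0 = 1`. -/
lemma ae_zero [IsProbabilityMeasure P] (hB : IsFractionalBrownianMotion H B P) (hH : H ≠ 0) :
    ∀ᵐ ω ∂P, B 0 ω = 0 := by
  have hL := (hB.gaussian.hasGaussianLaw_eval 0).memLp_two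
  have hv : Var[B 0; P] = 0 := by
    rw [← covariance_self hL.aestronglyMeasurable.aemeasurable, hB.covariance_eq]
    simp [Real.zero_rpow (mul_ne_zero two_ne_zero hH)]
  have h := (variance_eq_integral hL.aestronglyMeasurable.aemeasurable).symm.trans hv
  rw [integral_eq_zero_iff_of_nonneg (fun ω => sq_nonneg _)] at h
  · filter_upwards [h] with ω hω
    simpa [hB.centered] using hω
  · simpa [hB.centered] using hL.integrable_sq

lemma prob_forall_le_bound [IsProbabilityMeasure P] (hB : IsFractionalBrownianMotion H B P)
    (hH0 : 0 < H) (hH1 : H < 1) (M : ℝ) {n : ℕ} (hn : 0 < n) {q δ κ : ℝ} (hq : 1 < q)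
    (hδ : 0 < δ) (hκ : 0 < κ) :
    δ * (P.real {ω | ∀ t, B t ω ≤ M} - δ) ≤
      |M| * q⁻¹ ^ H + κ + (1 / n + (q⁻¹ ^ H + q⁻¹ ^ (1 - H))) / κ := by
  have hq0 : 0 < q := by linarith
  have hpow : ∀ k : ℕ, q ≤ q ^ (k + 1) := fun k => le_self_pow₀ hq.le (by simp)
  -- The exponents start at `1`, so every time is at least `q` and the normalised bound is at most
  -- `|M| * q⁻¹ ^ H`.
  let t : Fin n → ℝ≥0 := fun k => ⟨q ^ (k.1 + 1), by positivity⟩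
  have htc : ∀ k, (t k : ℝ) = q ^ (k.1 + 1) := fun k => rfl
  have ht0 : ∀ k, 0 < (t k : ℝ) := fun k => by rw [htc]; positivity
  have htH : ∀ k, 0 < (t k : ℝ) ^ H := fun k => Real.rpow_pos_of_pos (ht0 k) H
  let Z : Fin n → Ω → ℝ := fun k ω => B (t k) ω / (t k : ℝ) ^ H
  have hcov : ∀ j k, cov[Z j, Z k; P] =
      ((t j : ℝ) ^ (2 * H) + (t k : ℝ) ^ (2 * H) - |(t k : ℝ) - t j| ^ (2 * H)) / 2 /
        ((t j : ℝ) ^ H * (t k : ℝ) ^ H) := by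
    intro j k
    rw [covariance_fun_div_left, covariance_fun_div_right, hB.covariance_eq, div_div _ ((t k : ℝ) ^ H),
      mul_comm ((t k : ℝ) ^ H)]
  have hZ : ∀ k, HasGaussianLaw (Z k) P := fun k => by
    have h := (hB.gaussian.hasGaussianLaw_eval (t k)).fun_smul ((t k : ℝ) ^ H)⁻¹
    simpa only [smul_eq_mul, inv_mul_eq_div] using h
  have hlt : ∀ j k : Fin n, j < k → cov[Z j, Z k; P] ≤ q⁻¹ ^ H + q⁻¹ ^ (1 - H) := by
    intro j k hjk
    have hle : t j ≤ t k := by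
      rw [← NNReal.coe_le_coe, htc, htc]
      exact pow_le_pow_right₀ hq.le (by simpa using hjk.le)
    have hr : (t j : ℝ) / t k ≤ q⁻¹ := by
      rw [div_le_iff₀ (ht0 k), inv_mul_eq_div, le_div_iff₀ hq0, htc, htc, ← pow_succ]
      exact pow_le_pow_right₀ hq.le (by simpa using hjk)
    have hr0 : 0 ≤ (t j : ℝ) / t k := by positivity
    rw [hcov]
    refine (fbm_correlation_le hH0 hH1 (ht0 j) hle).trans ?_
    exact add_le_add (Real.rpow_le_rpow hr0 hr hH0.le) (Real.rpow_le_rpow hr0 hr (by linarith))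
  have key := _root_.prob_forall_le_bound hn hZ (fun k => ?_) (fun k => ?_)
    (η := q⁻¹ ^ H + q⁻¹ ^ (1 - H)) (by positivity) (fun j k hjk => ?_)
    (m := |M| * q⁻¹ ^ H) (by positivity) hδ hκ
  · refine le_trans ?_ key
    have hsub : {ω | ∀ t, B t ω ≤ M} ⊆ {ω | ∀ k, Z k ω ≤ |M| * q⁻¹ ^ H} := by
      intro ω hω k
      have hω : ∀ t, B t ω ≤ M := hω
      show B (t k) ω / (t k : ℝ) ^ H ≤ |M| * q⁻¹ ^ H
      rw [Real.inv_rpow hq0.le, ← div_eq_mul_inv]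
      have h1 : q ^ H ≤ (t k : ℝ) ^ H := Real.rpow_le_rpow hq0.le (hpow _) hH0.le
      have h2 : 0 < q ^ H := Real.rpow_pos_of_pos hq0 H
      calc B (t k) ω / (t k : ℝ) ^ H ≤ |M| / (t k : ℝ) ^ H := by
            gcongr
            exact (hω _).trans (le_abs_self M)
        _ ≤ |M| / q ^ H := by gcongr
    have h3 := measureReal_mono hsub (measure_ne_top P _)
    gcongr
  · simp only [Z]
    rw [integral_div, hB.centered, zero_div]
  · rw [← covariance_self (hZ k).aemeasurable, hcov, sub_self, abs_zero,
      Real.zero_rpow (by positivity), ← Real.rpow_add (ht0 k), sub_zero, ← two_mul H]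
    have := Real.rpow_pos_of_pos (ht0 k) (2 * H)
    field_simp
    norm_num
  · rcases lt_or_gt_of_ne hjk with h | h
    · exact hlt j k h
    · rw [covariance_comm]
      exact hlt k j h

lemma prob_forall_le_eq_zero [IsProbabilityMeasure P] (hB : IsFractionalBrownianMotion H B P)
    (hH0 : 0 < H) (hH1 : H < 1) (M : ℝ) : P {ω | ∀ t, B t ω ≤ M} = 0 := by
  rw [← measureReal_eq_zero_iff]
  set p := P.real {ω | ∀ t, B t ω ≤ M} with hp
  by_contra hne
  have hp0 : 0 < p := lt_of_le_of_ne measureReal_nonneg (Ne.symm hne)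
  have hlim0 : ∀ a : ℝ, 0 < a → Tendsto (fun q : ℝ => q⁻¹ ^ a) atTop (𝓝 0) := fun a ha => by
    simpa [Real.zero_rpow ha.ne'] using tendsto_inv_atTop_zero.rpow_const (p := a) (Or.inr ha.le)
  -- With `n` fixed, `q → ∞` removes the level `M` and the correlations; `n → ∞` then leaves `p² / 4
  -- ≤ p² / 16`, impossible for `p > 0`.
  have hn : ∀ n : ℕ, 0 < n →
      p / 2 * (p - p / 2) ≤ p ^ 2 / 16 + (1 / n) / (p ^ 2 / 16) := by
    intro n hn
    have hlim : Tendsto (fun q : ℝ => |M| * q⁻¹ ^ H + p ^ 2 / 16 +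
        (1 / n + (q⁻¹ ^ H + q⁻¹ ^ (1 - H))) / (p ^ 2 / 16)) atTop
        (𝓝 (|M| * 0 + p ^ 2 / 16 + (1 / n + (0 + 0)) / (p ^ 2 / 16))) :=
      (((hlim0 H hH0).const_mul _).add_const _).add
        ((((hlim0 H hH0).add (hlim0 (1 - H) (by linarith))).const_add _).div_const _)
    have h := ge_of_tendsto hlim (by
      filter_upwards [eventually_gt_atTop 1] with q hq
      exact hB.prob_forall_le_bound hH0 hH1 M hn hq (δ := p / 2) (κ := p ^ 2 / 16)
        (by positivity) (by positivity))
    simpa using h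
  have hlim : Tendsto (fun n : ℕ => p ^ 2 / 16 + (1 / (n : ℝ)) / (p ^ 2 / 16)) atTop
      (𝓝 (p ^ 2 / 16 + 0 / (p ^ 2 / 16))) :=
    (tendsto_one_div_atTop_nhds_zero_nat.div_const _).const_add _
  have h := ge_of_tendsto hlim (by
    filter_upwards [eventually_gt_atTop 0] with n h
    exact hn n h)
  have : 0 < p ^ 2 := by positivity
  rw [zero_div] at h
  nlinarith

/-- Almost every path of a fractional Brownian motion is unbounded above. -/
theorem ae_unbounded_above [IsProbabilityMeasure P] (hB : IsFractionalBrownianMotion H B P)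
    (hH0 : 0 < H) (hH1 : H < 1) : ∀ᵐ ω ∂P, ∀ M : ℝ, ∃ t, M < B t ω := by
  have h : ∀ᵐ ω ∂P, ∀ n : ℕ, ∃ t, (n : ℝ) < B t ω := by
    refine ae_all_iff.2 fun n => ?_
    have h := hB.prob_forall_le_eq_zero hH0 hH1 n
    rw [ae_iff]
    simpa using h
  filter_upwards [h] with ω hω M
  obtain ⟨n, hn⟩ := exists_nat_ge M
  obtain ⟨t, ht⟩ := hω n
  exact ⟨t, hn.trans_lt ht⟩

end IsFractionalBrownianMotion

/-! ### Hitting the root of the drift. -/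

section Hitting

variable {α σ x₀ z : ℝ} {b : ℝ → ℝ} {w : ℝ≥0 → ℝ}

lemma IsPositiveSolution.sub_le_of_root_le (hb : DriftAssumption α b) (hz : 0 < z) (hbz : b z = 0)
    {x : ℝ≥0 → ℝ} (hx : IsPositiveSolution b σ w x₀ x) {s t : ℝ≥0} (hst : s ≤ t)
    (h : ∀ u, s < u → u ≤ t → z ≤ x u) : x t - x s ≤ σ * (w t - w s) := by
  have h1 := (hx.solvesOn t).sub_eq hb s.coe_nonneg (NNReal.coe_le_coe.2 hst) le_rfl
  simp only [Real.toNNReal_coe] at h1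
  have h2 : ∫ u in (s : ℝ)..t, b (x u.toNNReal) ≤ 0 := by
    rw [intervalIntegral.integral_of_le (NNReal.coe_le_coe.2 hst)]
    refine setIntegral_nonpos measurableSet_Ioc fun u hu => ?_
    exact hbz ▸ hb.le_of_le hz (h _ (Real.lt_toNNReal_iff_coe_lt.2 hu.1)
      (Real.toNNReal_le_iff_le_coe.2 hu.2))
  linarith

/-- The level is not required to be the root: the approximations of the solution from zero are only
known to stay below `z + y`. -/
lemma IsPositiveSolution.le_sub_of_le (hb : DriftAssumption α b)
    {x : ℝ≥0 → ℝ} (hx : IsPositiveSolution b σ w x₀ x) {s t : ℝ≥0} (hst : s ≤ t)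
    (h : ∀ u, s < u → u ≤ t → x u ≤ z) :
    (t - s) * b z + σ * (w t - w s) ≤ x t - x s := by
  have hst' : (s : ℝ) ≤ t := NNReal.coe_le_coe.2 hst
  have h1 := (hx.solvesOn t).sub_eq hb s.coe_nonneg hst' le_rfl
  simp only [Real.toNNReal_coe] at h1
  have h2 : ∫ _ in (s : ℝ)..t, b z ≤ ∫ u in (s : ℝ)..t, b (x u.toNNReal) := by
    refine intervalIntegral.integral_mono_on_of_le_Ioo hst' intervalIntegrable_const
      (((hx.solvesOn t).continuous_drift hb).intervalIntegrable _ _) fun u hu => ?_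
    exact hb.le_of_le (hx.pos _) (h _ (Real.lt_toNNReal_iff_coe_lt.2 hu.1)
      (Real.toNNReal_le_iff_le_coe.2 hu.2.le))
  rw [intervalIntegral.integral_const, smul_eq_mul] at h2
  linarith

/-- A continuous path which is pushed towards `z` and perturbed by a noise that is unbounded from
both sides crosses the level `z` after any time. -/
lemma exists_hit_of_unbounded_noise {X v : ℝ≥0 → ℝ} (hX : Continuous X) (hv : Continuous v)
    (hup : ∀ M, ∃ t, M < v t) (hdown : ∀ M, ∃ t, v t < M) {s : ℝ≥0}
    (hXu : ∀ t, s ≤ t → (∀ u, s < u → u ≤ t → z < X u) → X t - X s ≤ v t - v s)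
    (hXl : ∀ t, s ≤ t → (∀ u, s < u → u ≤ t → X u < z) → v t - v s ≤ X t - X s) :
    ∃ t, s < t ∧ X t = z := by
  by_contra! hne
  have hside : (∀ u, s < u → z < X u) ∨ (∀ u, s < u → X u < z) := by
    by_contra! hcon
    obtain ⟨⟨p, hp, hpz⟩, ⟨q, hq, hqz⟩⟩ := hcon
    obtain ⟨t, ht, htz⟩ := (isPreconnected_Ioi (a := s)).intermediate_value hp hq
      hX.continuousOn ⟨hpz, hqz⟩
    exact hne t ht htz
  rcases hside with h | h
  -- Going below the minimum of `v` on `[0, s]` forces the time found to lie after `s`.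
  · obtain ⟨m, hm⟩ := (isCompact_Icc (a := (0 : ℝ≥0)) (b := s)).bddBelow_image hv.continuousOn
    obtain ⟨t, ht⟩ := hdown (min m (z - X s + v s))
    rcases le_or_gt t s with hts | hts
    · have := hm ⟨t, ⟨zero_le, hts⟩, rfl⟩
      linarith [ht.trans_le (min_le_left _ _)]
    · have h1 := hXu t hts.le fun u hu _ => h u hu
      have h2 := h t hts
      linarith [ht.trans_le (min_le_right _ _)]
  · obtain ⟨m, hm⟩ := (isCompact_Icc (a := (0 : ℝ≥0)) (b := s)).bddAbove_image hv.continuousOn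
    obtain ⟨t, ht⟩ := hup (max m (z - X s + v s))
    rcases le_or_gt t s with hts | hts
    · have := hm ⟨t, ⟨zero_le, hts⟩, rfl⟩
      linarith [(le_max_left _ _).trans_lt ht]
    · have h1 := hXl t hts.le fun u hu _ => h u hu
      have h2 := h t hts
      linarith [(le_max_right _ _).trans_lt ht]

/-- The solution map at zero is the uniform limit of the solutions started at `y → 0+`, which
decrease to it at speed at most `y`. -/
lemma exists_limit_positiveSolution (hb : DriftAssumption α b) (hα : 0 < α)
    (hw : LocallyHolder α w) (hw0 : w 0 = 0) :
    ∃ X : ℝ≥0 → ℝ, ∀ y, 0 < y → ∀ t,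
      X t ≤ positiveSolution b σ w y t ∧ positiveSolution b σ w y t ≤ X t + y := by
  have hV : ∀ y, 0 < y → IsPositiveSolution b σ w y (positiveSolution b σ w y) := fun y hy =>
    isPositiveSolution_positiveSolution hb hα hw hw0 hy
  have hbdd : ∀ t, BddBelow (Set.range fun y : Set.Ioi (0 : ℝ) => positiveSolution b σ w y t) :=
    fun t => ⟨0, by rintro _ ⟨y, rfl⟩; exact ((hV y y.2).pos t).le⟩
  refine ⟨fun t => ⨅ y : Set.Ioi (0 : ℝ), positiveSolution b σ w y t, fun y hy t =>
    ⟨ciInf_le (hbdd t) ⟨y, hy⟩, ?_⟩⟩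
  rw [← sub_le_iff_le_add]
  have : Nonempty (Set.Ioi (0 : ℝ)) := ⟨⟨y, hy⟩⟩
  refine le_ciInf fun y' => ?_
  have hy' : (0 : ℝ) < y' := y'.2
  have h1 := (hV y hy).solvesOn t
  have h2 := (hV y' hy').solvesOn t
  rcases le_total (y' : ℝ) y with h | h
  · have h3 := h1.abs_sub_le hb h2 le_rfl t.coe_nonneg le_rfl
    rw [h1.initial t.coe_nonneg (by simpa using hw0), h2.initial t.coe_nonneg (by simpa using hw0),
      abs_of_nonneg (sub_nonneg.2 h)] at h3
    simp only [Real.toNNReal_coe] at h3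
    linarith [le_abs_self (positiveSolution b σ w y t - positiveSolution b σ w y' t)]
  · have h3 := h1.le_of_initial_le hb h2 h t.coe_nonneg le_rfl
    simp only [Real.toNNReal_coe] at h3
    linarith

theorem exists_itoMap_eq_root (hb : DriftAssumption α b) (hα : 0 < α)
    (hw : LocallyHolder α w) (hw0 : w 0 = 0) (hup : ∀ M, ∃ t, M < σ * w t)
    (hdown : ∀ M, ∃ t, σ * w t < M) (hz : 0 < z) (hbz : b z = 0) (x₀ s : ℝ≥0) :
    ∃ t, s < t ∧ itoMap b σ w x₀ t = z := by
  have hv : Continuous fun t => σ * w t := continuous_const.mul (hw.continuous hα)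
  have hV : ∀ y, 0 < y → IsPositiveSolution b σ w y (positiveSolution b σ w y) := fun y hy =>
    isPositiveSolution_positiveSolution hb hα hw hw0 hy
  by_cases hx₀ : 0 < x₀
  · simp only [itoMap, if_pos hx₀]
    have hx := hV x₀ hx₀
    refine exists_hit_of_unbounded_noise hx.continuous hv hup hdown (fun t hst h => ?_)
      fun t hst h => ?_
    · rw [← mul_sub]
      exact hx.sub_le_of_root_le hb hz hbz hst fun u h1 h2 => (h u h1 h2).le
    · have := hx.le_sub_of_le hb hst fun u h1 h2 => (h u h1 h2).le
      rw [hbz, mul_zero, zero_add] at this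
      rwa [← mul_sub]
  -- Neither positivity of the limit nor an integral equation for it is needed: continuity and the
  -- two increment inequalities survive the limit.
  · obtain ⟨X, hX⟩ := exists_limit_positiveSolution (σ := σ) hb hα hw hw0
    have hid : Tendsto (fun y : ℝ => y) (𝓝[>] 0) (𝓝 0) := nhdsWithin_le_nhds
    have hlim : ∀ t, Tendsto (fun y => positiveSolution b σ w y t) (𝓝[>] 0) (𝓝 (X t)) := by
      intro t
      refine tendsto_of_tendsto_of_tendsto_of_le_of_le' tendsto_const_nhds
        (by simpa using hid.const_add (X t)) ?_ ?_
      · filter_upwards [self_mem_nhdsWithin] with y hy using (hX y hy t).1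
      · filter_upwards [self_mem_nhdsWithin] with y hy using (hX y hy t).2
    have hunif : TendstoUniformly (fun y t => positiveSolution b σ w y t) X (𝓝[>] (0 : ℝ)) := by
      refine Metric.tendstoUniformly_iff.2 fun ε hε => ?_
      filter_upwards [Ioo_mem_nhdsGT hε] with y hy t
      have h := hX y hy.1 t
      rw [Real.dist_eq, abs_lt]
      constructor <;> linarith [hy.1, hy.2]
    have hXc : Continuous X := hunif.continuous (Eventually.frequently (by
      filter_upwards [self_mem_nhdsWithin] with y hy using (hV y hy).continuous))
    simp only [itoMap, if_neg hx₀, (hlim _).limUnder_eq]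
    refine exists_hit_of_unbounded_noise hXc hv hup hdown (fun t hst h => ?_) fun t hst h => ?_
    · rw [← mul_sub]
      refine le_of_tendsto ((hlim t).sub (hlim s)) ?_
      filter_upwards [self_mem_nhdsWithin] with y hy
      exact (hV y hy).sub_le_of_root_le hb hz hbz hst fun u h1 h2 =>
        (h u h1 h2).le.trans (hX y hy u).1
    -- From `X u < z` one only gets a bound `z + y` on the approximations, hence a drift of at least
    -- `b (z + y)`, which tends to `b z = 0`.
    · have hbl : Tendsto (fun y => (t - s) * b (z + y) + σ * (w t - w s)) (𝓝[>] 0)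
          (𝓝 ((t - s) * b z + σ * (w t - w s))) := by
        refine (((hb.continuousOn.continuousAt (Ioi_mem_nhds hz)).tendsto.comp ?_).const_mul
          _).add_const _
        simpa using hid.const_add z
      rw [hbz, mul_zero, zero_add] at hbl
      rw [← mul_sub]
      refine le_of_tendsto_of_tendsto hbl ((hlim t).sub (hlim s)) ?_
      filter_upwards [self_mem_nhdsWithin] with y hy
      exact (hV y hy).le_sub_of_le hb hst fun u h1 h2 => by linarith [h u h1 h2, (hX y hy u).2]

end Hitting

theorem mainTheorem12 {Ω : Type*} [MeasurableSpace Ω] (P : Measure Ω) [IsProbabilityMeasure P]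
    (α H σ : ℝ) (hα : 0 < α) (hαH : α < H) (hH : H < 1) (hσ : σ ≠ 0)
    (b : ℝ → ℝ) (hb : DriftAssumption α b)
    (B : ℝ≥0 → Ω → ℝ) (hB : IsFractionalBrownianMotion H B P)
    (hBpaths : ∀ᵐ ω ∂P, LocallyHolder α (fun t => B t ω)) :
    ∃ x_b : ℝ, (0 < x_b ∧ b x_b = 0 ∧ ∀ y : ℝ, 0 < y → b y = 0 → y = x_b) ∧
      ∀ x₀ t_star : ℝ≥0, ∀ᵐ ω ∂P,
        hitAfter (fun t => itoMap b σ (fun s => B s ω) x₀ t) t_star x_b < ∞ := by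
  obtain ⟨z, hz, hbz, huniq⟩ := hb.exists_root
  refine ⟨z, ⟨hz, hbz, huniq⟩, fun x₀ s => ?_⟩
  have hH0 : 0 < H := hα.trans hαH
  filter_upwards [hBpaths, hB.ae_zero hH0.ne', hB.ae_unbounded_above hH0 hH,
    hB.neg.ae_unbounded_above hH0 hH] with ω hw hw0 hup hdown
  have hup' : ∀ M, ∃ t, M < σ * B t ω := by
    intro M
    rcases lt_or_gt_of_ne hσ with h | h
    · obtain ⟨t, ht⟩ := hdown (-(M / σ))
      exact ⟨t, by rw [neg_lt_neg_iff, lt_div_iff_of_neg' h] at ht; exact ht⟩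
    · obtain ⟨t, ht⟩ := hup (M / σ)
      exact ⟨t, (div_lt_iff₀' h).1 ht⟩
  have hdown' : ∀ M, ∃ t, σ * B t ω < M := by
    intro M
    rcases lt_or_gt_of_ne hσ with h | h
    · obtain ⟨t, ht⟩ := hup (M / σ)
      exact ⟨t, (div_lt_iff_of_neg' h).1 ht⟩
    · obtain ⟨t, ht⟩ := hdown (-(M / σ))
      exact ⟨t, by rw [neg_lt_neg_iff, lt_div_iff₀' h] at ht; exact ht⟩
  obtain ⟨t, hst, ht⟩ := exists_itoMap_eq_root hb hα hw hw0 hup' hdown' hz hbz x₀ s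
  exact (iInf₂_le t ⟨hst, ht⟩).trans_lt ENNReal.coe_lt_top
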